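/- Let $A\in\mathbb C^{n\times n}$ and $b,c\in\mathbb C^n$, and let $f$ be analytic on an open set $\Omega\subseteq\mathbb C$ that contains the spectra of $A$ and of $A+bc^*$. For a square complex matrix $M$ whose spectrum lies in $\Omega$, the matrix function $f(M)$ is defined by the Cauchy integral $$f(M)=\frac1{2\pi i}\int_\Gamma f(z)\,(zI-M)^{-1}\,dz,$$ where $\Gamma$ consists of the positively oriented circles of radius $r$ around the distinct eigenvalues of $M$, and $r>0$ is sufficiently small (the value is the same for all sufficiently small $r$). Define the block matrix $$\mathcal A=\begin{bmatrix}A & bc^*\\ 0 & A+bc^*\end{bmatrix}.$$ Then $f(A)$, $f(A+bc^*)$ and $f(\mathcal A)$ exist, and $$f(\mathcal A)=\begin{bmatrix}f(A) & f(A+bc^*)-f(A)\\ 0 & f(A+bc^*)\end{bmatrix}.$$ -/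

import Mathlib

open Filter Topology

/-- The Cauchy integral `(1 / 2πi) ∫_Γ f(z) (zI - M)⁻¹ dz`, taken entry by entry, where `Γ` is the
contour made of the positively oriented circles of radius `r` around the (finitely many, distinct)
eigenvalues of the square matrix `M`. -/
noncomputable def cauchyIntegral {ι : Type*} [Fintype ι] [DecidableEq ι]
    (f : ℂ → ℂ) (M : Matrix ι ι ℂ) (r : ℝ) : Matrix ι ι ℂ :=
  Matrix.of fun i j =>
    (2 * (Real.pi : ℂ) * Complex.I)⁻¹ *
      ∑ μ ∈ (Matrix.finite_spectrum M).toFinset,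
        ∮ z in C(μ, r), f z * (z • (1 : Matrix ι ι ℂ) - M)⁻¹ i j

/-- `F` is the value `f(M)` of the function `f` at the matrix `M`: the Cauchy integral of
`f(z) (zI - M)⁻¹` along the circles of radius `r` around the eigenvalues of `M` equals `F` for all
sufficiently small `r > 0`. There is at most one such `F`. -/
def IsMatrixFunction {ι : Type*} [Fintype ι] [DecidableEq ι]
    (f : ℂ → ℂ) (M F : Matrix ι ι ℂ) : Prop :=
  ∀ᶠ r : ℝ in 𝓝[>] 0, cauchyIntegral f M r = F

open Classical in
/-- The matrix function `f(M)` (with the value `0` if `f(M)` does not exist). -/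
noncomputable def matrixFunction {ι : Type*} [Fintype ι] [DecidableEq ι]
    (f : ℂ → ℂ) (M : Matrix ι ι ℂ) : Matrix ι ι ℂ :=
  if h : ∃ F, IsMatrixFunction f M F then h.choose else 0

/-- The rank-one matrix `b c^*`. -/
def rankOne {n : ℕ} (b c : Fin n → ℂ) : Matrix (Fin n) (Fin n) ℂ :=
  Matrix.vecMulVec b (star c)

/-- The block matrix `[[A, b c^*], [0, A + b c^*]]`. -/
def blockUpdate {n : ℕ} (A : Matrix (Fin n) (Fin n) ℂ) (b c : Fin n → ℂ) :
    Matrix (Fin n ⊕ Fin n) (Fin n ⊕ Fin n) ℂ :=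
  Matrix.fromBlocks A (rankOne b c) 0 (A + rankOne b c)

/-! Write `B = A + bc^*`, so the corner block `bc^*` is `B - A`. By the resolvent identity
`(z-A)⁻¹(B-A)(z-B)⁻¹ = (z-B)⁻¹ - (z-A)⁻¹`, the resolvent of the block matrix has this difference as
its corner (`resolvent_fromBlocks_sub`), and integrating blockwise gives the formula. The three
contours differ, but the extra circles enclose only regular points and contribute zero
(`eventually_cauchyIntegral_apply_eq_sum`). -/

/-- The circle integrals around an isolated singularity do not depend on the small radius. -/
lemma exists_eventually_circleIntegral_eq {g : ℂ → ℂ} {μ : ℂ}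
    (hg : ∀ᶠ z in 𝓝[≠] μ, DifferentiableAt ℂ g z) :
    ∃ I : ℂ, ∀ᶠ r : ℝ in 𝓝[>] 0, (∮ z in C(μ, r), g z) = I := by
  obtain ⟨ε, hε, h⟩ := Metric.mem_nhdsWithin_iff.1 hg
  have hd : ∀ z, 0 < dist z μ → dist z μ < ε → DifferentiableAt ℂ g z := fun z h0 h1 =>
    h ⟨h1, by simpa using dist_pos.1 h0⟩
  have key : ∀ r s : ℝ, 0 < r → r ≤ s → s < ε →
      (∮ z in C(μ, s), g z) = ∮ z in C(μ, r), g z := by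
    intro r s hr hrs hs
    refine Complex.circleIntegral_eq_of_differentiable_on_annulus_off_countable hr hrs
      Set.countable_empty ?_ ?_
    · rintro z ⟨hz1, hz2⟩
      refine (hd z ?_ ?_).continuousAt.continuousWithinAt
      · simp only [Metric.mem_ball, not_lt] at hz2; linarith
      · simp only [Metric.mem_closedBall] at hz1; linarith
    · rintro z ⟨⟨hz1, hz2⟩, -⟩
      refine hd z ?_ ?_
      · simp only [Metric.mem_closedBall, not_le] at hz2; linarith
      · simp only [Metric.mem_ball] at hz1; linarith
  refine ⟨∮ z in C(μ, ε / 2), g z, ?_⟩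
  filter_upwards [Ioo_mem_nhdsGT (half_pos hε)] with r hr
  exact (key r (ε / 2) hr.1 hr.2.le (by linarith)).symm

/-- Small circle integrals around a regular point vanish. -/
lemma eventually_circleIntegral_eq_zero {g : ℂ → ℂ} {μ : ℂ}
    (hg : ∀ᶠ z in 𝓝 μ, DifferentiableAt ℂ g z) :
    ∀ᶠ r : ℝ in 𝓝[>] 0, (∮ z in C(μ, r), g z) = 0 := by
  obtain ⟨ε, hε, h⟩ := Metric.eventually_nhds_iff.1 hg
  filter_upwards [Ioo_mem_nhdsGT hε] with r hr
  refine Complex.circleIntegral_eq_zero_of_differentiable_on_off_countable hr.1.le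
    Set.countable_empty ?_ ?_
  · intro z hz
    exact (h (lt_of_le_of_lt hz hr.2)).continuousAt.continuousWithinAt
  · rintro z ⟨hz, -⟩
    exact h (lt_trans hz hr.2)

/-- A property that holds near `μ` off `μ` holds on all small circles around `μ`. -/
lemma eventually_forall_mem_sphere {p : ℂ → Prop} {μ : ℂ} (hp : ∀ᶠ z in 𝓝[≠] μ, p z) :
    ∀ᶠ r : ℝ in 𝓝[>] 0, 0 < r ∧ ∀ z ∈ Metric.sphere μ r, p z := by
  obtain ⟨ε, hε, h⟩ := Metric.mem_nhdsWithin_iff.1 hp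
  filter_upwards [Ioo_mem_nhdsGT hε] with r hr
  refine ⟨hr.1, fun z hz => h ⟨?_, ?_⟩⟩
  · rw [Metric.mem_ball, Metric.mem_sphere.1 hz]; exact hr.2
  · rintro rfl
    simp only [Metric.mem_sphere, dist_self] at hz
    exact hr.1.ne hz

section Resolvent

variable {ι : Type*} [Fintype ι] [DecidableEq ι]

lemma differentiableAt_matrix_det {N : ℂ → Matrix ι ι ℂ} {z : ℂ}
    (hN : ∀ i j, DifferentiableAt ℂ (fun w => N w i j) z) :
    DifferentiableAt ℂ (fun w => (N w).det) z := by
  simp only [Matrix.det_apply']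
  fun_prop

lemma isUnit_det_of_notMem_spectrum {M : Matrix ι ι ℂ} {z : ℂ} (hz : z ∉ spectrum ℂ M) :
    IsUnit (z • (1 : Matrix ι ι ℂ) - M).det := by
  rw [← Matrix.isUnit_iff_isUnit_det]
  simpa [spectrum.mem_iff, Algebra.algebraMap_eq_smul_one] using hz

/-- The entries of the resolvent are differentiable off the spectrum. -/
lemma differentiableAt_resolvent_apply {M : Matrix ι ι ℂ} {z : ℂ} (hz : z ∉ spectrum ℂ M)
    (i j : ι) :
    DifferentiableAt ℂ (fun w => (w • (1 : Matrix ι ι ℂ) - M)⁻¹ i j) z := by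
  have hN : ∀ k l, DifferentiableAt ℂ (fun w : ℂ => (w • (1 : Matrix ι ι ℂ) - M) k l) z := by
    intro k l
    simp only [Matrix.sub_apply, Matrix.smul_apply, smul_eq_mul]
    fun_prop
  -- Cramer's rule: each entry is a quotient of determinants, the numerator having row `j` replaced
  -- by a constant unit vector.
  simp only [Matrix.inv_def, Matrix.smul_apply, Ring.inverse_eq_inv', smul_eq_mul,
    Matrix.adjugate_apply]
  refine ((differentiableAt_matrix_det hN).inv
    (isUnit_det_of_notMem_spectrum hz).ne_zero).mul (differentiableAt_matrix_det ?_)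
  intro k l
  by_cases hk : k = j
  · subst hk; simp
  · simpa only [Matrix.updateRow_ne hk] using hN k l

lemma differentiableAt_mul_resolvent_apply {f : ℂ → ℂ} {M : Matrix ι ι ℂ} {z : ℂ}
    (hf : AnalyticAt ℂ f z) (hz : z ∉ spectrum ℂ M) (i j : ι) :
    DifferentiableAt ℂ (fun w => f w * (w • (1 : Matrix ι ι ℂ) - M)⁻¹ i j) z :=
  hf.differentiableAt.mul (differentiableAt_resolvent_apply hz i j)

lemma eventually_nhdsNE_notMem_spectrum (M : Matrix ι ι ℂ) (μ : ℂ) :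
    ∀ᶠ z in 𝓝[≠] μ, z ∉ spectrum ℂ M := by
  -- `μ` may be an eigenvalue; the rest of the spectrum is finite, hence closed.
  have := (Matrix.finite_spectrum M).subset (Set.sdiff_subset (t := {μ}))
  filter_upwards [mem_nhdsWithin_of_mem_nhds
    (this.isClosed.isOpen_compl.mem_nhds (by simp : μ ∈ (spectrum ℂ M \ {μ})ᶜ)),
    self_mem_nhdsWithin] with z hz hne hmem
  exact hz ⟨hmem, hne⟩

lemma eventually_nhdsNE_differentiableAt {f : ℂ → ℂ} {μ : ℂ} (hf : AnalyticAt ℂ f μ)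
    (M : Matrix ι ι ℂ) (i j : ι) :
    ∀ᶠ z in 𝓝[≠] μ,
      DifferentiableAt ℂ (fun w => f w * (w • (1 : Matrix ι ι ℂ) - M)⁻¹ i j) z := by
  filter_upwards [eventually_nhdsNE_notMem_spectrum M μ,
    nhdsWithin_le_nhds hf.eventually_analyticAt] with z hz hfz
  exact differentiableAt_mul_resolvent_apply hfz hz i j

/-- Circles around regular points may be added to the contour. -/
lemma eventually_cauchyIntegral_apply_eq_sum {f : ℂ → ℂ} {M : Matrix ι ι ℂ} {S : Finset ℂ}
    (hS : spectrum ℂ M ⊆ S) (hf : ∀ μ ∈ S, AnalyticAt ℂ f μ) (i j : ι) :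
    ∀ᶠ r : ℝ in 𝓝[>] 0, cauchyIntegral f M r i j =
      (2 * (Real.pi : ℂ) * Complex.I)⁻¹ *
        ∑ μ ∈ S, ∮ z in C(μ, r), f z * (z • (1 : Matrix ι ι ℂ) - M)⁻¹ i j := by
  have h : ∀ μ ∈ S, ∀ᶠ r : ℝ in 𝓝[>] 0, μ ∉ spectrum ℂ M →
      (∮ z in C(μ, r), f z * (z • (1 : Matrix ι ι ℂ) - M)⁻¹ i j) = 0 := by
    intro μ hμ
    by_cases hm : μ ∈ spectrum ℂ M
    · exact Eventually.of_forall fun r h => absurd hm h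
    · refine (eventually_circleIntegral_eq_zero ?_).mono fun r hr _ => hr
      filter_upwards [(Matrix.finite_spectrum M).isClosed.isOpen_compl.mem_nhds hm,
        (hf μ hμ).eventually_analyticAt] with z hz hfz
      exact differentiableAt_mul_resolvent_apply hfz hz i j
  filter_upwards [(Filter.eventually_all_finset S).2 h] with r hr
  simp only [cauchyIntegral, Matrix.of_apply]
  congr 1
  refine Finset.sum_subset (fun μ hμ => hS (by simpa using hμ)) fun μ hμ hn => ?_
  exact hr μ hμ (by simpa using hn)

lemma exists_isMatrixFunction {f : ℂ → ℂ} {M : Matrix ι ι ℂ}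
    (hf : ∀ μ ∈ spectrum ℂ M, AnalyticAt ℂ f μ) : ∃ F, IsMatrixFunction f M F := by
  -- The implication sits under `∃` so that `choose` gives a total `I`; its values off the spectrum
  -- are never used.
  have h : ∀ (i j : ι) (μ : ℂ), ∃ I : ℂ, μ ∈ spectrum ℂ M → ∀ᶠ r : ℝ in 𝓝[>] 0,
      (∮ z in C(μ, r), f z * (z • (1 : Matrix ι ι ℂ) - M)⁻¹ i j) = I := by
    intro i j μ
    by_cases hm : μ ∈ spectrum ℂ M
    · obtain ⟨I, hI⟩ := exists_eventually_circleIntegral_eq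
        (eventually_nhdsNE_differentiableAt (hf μ hm) M i j)
      exact ⟨I, fun _ => hI⟩
    · exact ⟨0, fun h => absurd h hm⟩
  choose I hI using h
  refine ⟨Matrix.of fun i j => (2 * (Real.pi : ℂ) * Complex.I)⁻¹ *
    ∑ μ ∈ (Matrix.finite_spectrum M).toFinset, I i j μ, ?_⟩
  have : ∀ i j, ∀ᶠ r : ℝ in 𝓝[>] 0, ∀ μ ∈ (Matrix.finite_spectrum M).toFinset,
      (∮ z in C(μ, r), f z * (z • (1 : Matrix ι ι ℂ) - M)⁻¹ i j) = I i j μ := fun i j =>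
    (Filter.eventually_all_finset _).2 fun μ hμ => hI i j μ (by simpa using hμ)
  filter_upwards [Filter.eventually_all.2 fun i => Filter.eventually_all.2 (this i)] with r hr
  ext i j
  simp only [cauchyIntegral, Matrix.of_apply]
  rw [Finset.sum_congr rfl (hr i j)]

lemma isMatrixFunction_matrixFunction {f : ℂ → ℂ} {M : Matrix ι ι ℂ}
    (h : ∃ F, IsMatrixFunction f M F) : IsMatrixFunction f M (matrixFunction f M) := by
  rw [matrixFunction, dif_pos h]
  exact h.choose_spec

lemma IsMatrixFunction.unique {f : ℂ → ℂ} {M F G : Matrix ι ι ℂ}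
    (hF : IsMatrixFunction f M F) (hG : IsMatrixFunction f M G) : F = G := by
  obtain ⟨r, h1, h2⟩ := (hF.and hG).exists
  exact h1.symm.trans h2

end Resolvent

section Block

variable {m : Type*} [Fintype m] [DecidableEq m]

lemma spectrum_fromBlocks_zero₂₁ (A B C : Matrix m m ℂ) :
    spectrum ℂ (Matrix.fromBlocks A C 0 B) = spectrum ℂ A ∪ spectrum ℂ B := by
  ext z
  have h : algebraMap ℂ (Matrix (m ⊕ m) (m ⊕ m) ℂ) z - Matrix.fromBlocks A C 0 B =
      Matrix.fromBlocks (algebraMap ℂ (Matrix m m ℂ) z - A) (-C) 0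
        (algebraMap ℂ (Matrix m m ℂ) z - B) := by
    simp only [Algebra.algebraMap_eq_smul_one, ← Matrix.fromBlocks_one, Matrix.fromBlocks_smul,
      sub_eq_add_neg, Matrix.fromBlocks_neg, Matrix.fromBlocks_add]
    simp
  rw [Set.mem_union, spectrum.mem_iff, spectrum.mem_iff, spectrum.mem_iff, h,
    Matrix.isUnit_fromBlocks_zero₂₁, not_and_or]

/-- The resolvent of `[[A, B - A], [0, B]]`; its upper right block is the difference of the
resolvents of `B` and `A`. -/
lemma resolvent_fromBlocks_sub (A B : Matrix m m ℂ) {z : ℂ} (hA : z ∉ spectrum ℂ A)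
    (hB : z ∉ spectrum ℂ B) :
    (z • (1 : Matrix (m ⊕ m) (m ⊕ m) ℂ) - Matrix.fromBlocks A (B - A) 0 B)⁻¹ =
      Matrix.fromBlocks (z • (1 : Matrix m m ℂ) - A)⁻¹
        ((z • (1 : Matrix m m ℂ) - B)⁻¹ - (z • (1 : Matrix m m ℂ) - A)⁻¹) 0
        (z • (1 : Matrix m m ℂ) - B)⁻¹ := by
  have hA' := Matrix.mul_nonsing_inv _ (isUnit_det_of_notMem_spectrum hA)
  have hB' := Matrix.mul_nonsing_inv _ (isUnit_det_of_notMem_spectrum hB)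
  refine Matrix.inv_eq_right_inv ?_
  -- With the corner `-(B - A)` written as `(z - B) - (z - A)`, the product telescopes using only
  -- right inverses.
  have h : z • (1 : Matrix (m ⊕ m) (m ⊕ m) ℂ) - Matrix.fromBlocks A (B - A) 0 B =
      Matrix.fromBlocks (z • (1 : Matrix m m ℂ) - A)
        ((z • (1 : Matrix m m ℂ) - B) - (z • (1 : Matrix m m ℂ) - A)) 0
        (z • (1 : Matrix m m ℂ) - B) := by
    rw [← Matrix.fromBlocks_one, Matrix.fromBlocks_smul, sub_eq_add_neg (Matrix.fromBlocks _ _ _ _),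
      Matrix.fromBlocks_neg, Matrix.fromBlocks_add]
    congr 1 <;> simp [sub_eq_add_neg]
    abel
  rw [h, Matrix.fromBlocks_multiply, ← Matrix.fromBlocks_one]
  congr 1
  · simp [hA']
  · rw [mul_sub, sub_mul (z • (1 : Matrix m m ℂ) - B), hA', hB']; abel
  · simp
  · simp [hB']

/-- All three integrals are compared on one contour, the circles around the eigenvalues of both `A`
and `B`. -/
lemma isMatrixFunction_fromBlocks_sub {f : ℂ → ℂ} {A B F G : Matrix m m ℂ}
    (hA : ∀ μ ∈ spectrum ℂ A, AnalyticAt ℂ f μ) (hB : ∀ μ ∈ spectrum ℂ B, AnalyticAt ℂ f μ)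
    (hF : IsMatrixFunction f A F) (hG : IsMatrixFunction f B G) :
    IsMatrixFunction f (Matrix.fromBlocks A (B - A) 0 B) (Matrix.fromBlocks F (G - F) 0 G) := by
  set M := Matrix.fromBlocks A (B - A) 0 B
  have hspec : spectrum ℂ M = spectrum ℂ A ∪ spectrum ℂ B := spectrum_fromBlocks_zero₂₁ A B (B - A)
  set S := (Matrix.finite_spectrum M).toFinset with hS
  have hSmem : ∀ μ, μ ∈ S ↔ μ ∈ spectrum ℂ A ∨ μ ∈ spectrum ℂ B := by simp [hS, hspec]
  have hfS : ∀ μ ∈ S, AnalyticAt ℂ f μ := fun μ hμ => ((hSmem μ).1 hμ).elim (hA μ) (hB μ)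
  have hAS : spectrum ℂ A ⊆ S := fun μ hμ => (hSmem μ).2 (.inl hμ)
  have hBS : spectrum ℂ B ⊆ S := fun μ hμ => (hSmem μ).2 (.inr hμ)
  -- Small circles avoid both spectra, as the resolvent formula and the splitting of the corner
  -- integral require.
  have hcirc := (Filter.eventually_all_finset S).2 fun μ hμ =>
    eventually_forall_mem_sphere ((eventually_nhdsNE_notMem_spectrum A μ).and
      ((eventually_nhdsNE_notMem_spectrum B μ).and
        (nhdsWithin_le_nhds (hfS μ hμ).eventually_analyticAt)))
  filter_upwards [hF, hG, hcirc,
    Filter.eventually_all.2 fun i => Filter.eventually_all.2 fun j =>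
      eventually_cauchyIntegral_apply_eq_sum hAS hfS i j,
    Filter.eventually_all.2 fun i => Filter.eventually_all.2 fun j =>
      eventually_cauchyIntegral_apply_eq_sum hBS hfS i j] with r hFr hGr hc hAr hBr
  have hM : ∀ i j, cauchyIntegral f M r i j = (2 * (Real.pi : ℂ) * Complex.I)⁻¹ *
      ∑ μ ∈ S, ∮ z in C(μ, r), f z * Matrix.fromBlocks (z • (1 : Matrix m m ℂ) - A)⁻¹
        ((z • (1 : Matrix m m ℂ) - B)⁻¹ - (z • (1 : Matrix m m ℂ) - A)⁻¹) 0
        (z • (1 : Matrix m m ℂ) - B)⁻¹ i j := by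
    intro i j
    simp only [cauchyIntegral, Matrix.of_apply]
    congr 1
    refine Finset.sum_congr rfl fun μ hμ => ?_
    refine circleIntegral.integral_congr (hc μ hμ).1.le fun z hz => ?_
    obtain ⟨hzA, hzB, -⟩ := (hc μ hμ).2 z hz
    simp only [M, resolvent_fromBlocks_sub A B hzA hzB]
  ext (i | i) (j | j)
  · rw [hM, Matrix.fromBlocks_apply₁₁, ← hFr, hAr]; simp
  · rw [hM, Matrix.fromBlocks_apply₁₂, Matrix.sub_apply, ← hFr, ← hGr, hAr, hBr, ← mul_sub,
      ← Finset.sum_sub_distrib]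
    congr 1
    refine Finset.sum_congr rfl fun μ hμ => ?_
    obtain ⟨hr, hz⟩ := hc μ hμ
    rw [← circleIntegral.integral_sub]
    · simp [mul_sub]
    · exact ContinuousOn.circleIntegrable hr.le fun z h =>
        (differentiableAt_mul_resolvent_apply (hz z h).2.2 (hz z h).2.1
          i j).continuousAt.continuousWithinAt
    · exact ContinuousOn.circleIntegrable hr.le fun z h =>
        (differentiableAt_mul_resolvent_apply (hz z h).2.2 (hz z h).1
          i j).continuousAt.continuousWithinAt
  · rw [hM]; simp [circleIntegral]
  · rw [hM, Matrix.fromBlocks_apply₂₂, ← hGr, hBr]; simp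

end Block

theorem lemma2p1 (n : ℕ) (A : Matrix (Fin n) (Fin n) ℂ) (b c : Fin n → ℂ)
    (f : ℂ → ℂ) (Ω : Set ℂ) (hΩ : IsOpen Ω) (hf : AnalyticOnNhd ℂ f Ω)
    (hA : spectrum ℂ A ⊆ Ω) (hB : spectrum ℂ (A + rankOne b c) ⊆ Ω) :
    -- all three matrix functions exist
    IsMatrixFunction f A (matrixFunction f A) ∧
    IsMatrixFunction f (A + rankOne b c) (matrixFunction f (A + rankOne b c)) ∧
    IsMatrixFunction f (blockUpdate A b c) (matrixFunction f (blockUpdate A b c)) ∧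
    -- the block formula
    matrixFunction f (blockUpdate A b c) =
      Matrix.fromBlocks
        (matrixFunction f A) (matrixFunction f (A + rankOne b c) - matrixFunction f A)
        0 (matrixFunction f (A + rankOne b c)) := by
  have hfA : ∀ μ ∈ spectrum ℂ A, AnalyticAt ℂ f μ := fun μ hμ => hf μ (hA hμ)
  have hfB : ∀ μ ∈ spectrum ℂ (A + rankOne b c), AnalyticAt ℂ f μ := fun μ hμ => hf μ (hB hμ)
  have hFA := isMatrixFunction_matrixFunction (exists_isMatrixFunction hfA)
  have hFB := isMatrixFunction_matrixFunction (exists_isMatrixFunction hfB)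
  have hblock := isMatrixFunction_fromBlocks_sub hfA hfB hFA hFB
  -- The corner `(A + bc^*) - A` becomes `bc^*`, which makes the matrix `blockUpdate A b c` by
  -- definition.
  rw [add_sub_cancel_left] at hblock
  have hFblock : IsMatrixFunction f (blockUpdate A b c) (matrixFunction f (blockUpdate A b c)) :=
    isMatrixFunction_matrixFunction ⟨_, hblock⟩
  exact ⟨hFA, hFB, hFblock, hFblock.unique hblock⟩
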